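/- Let $M$ be a closed (compact, without boundary) oriented smooth three-dimensional manifold with $H^1(M;\mathbb{R})=H^2(M;\mathbb{R})=0$, and let $\mu$ be a volume form on $M$, i.e. a smooth nowhere vanishing 3-form. A smooth vector field $X$ on $M$ is called divergence-free if $d\,i_X\mu=0$. Let $X,Y,Z$ be divergence-free vector fields on $M$. Then there is a smooth 1-form $\eta_X$ on $M$ with $d\eta_X=i_X\mu$, and the Hopf invariant $$\mathcal{H}(X,Y)=\int_M \eta_X\wedge i_Y\mu$$ does not depend on the choice of such an $\eta_X$. Furthermore $\mathcal{H}(X,Y)=\mathcal{H}(Y,X)$ and $\mathcal{H}(X,Y+Z)=\mathcal{H}(X,Y)+\mathcal{H}(X,Z)$. -/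

import Mathlib

open scoped Manifold ContDiff Topology
open MeasureTheory

noncomputable section

namespace HopfInv

/-- The model space `ℝ³` of a three-dimensional manifold. -/
abbrev E3 : Type := EuclideanSpace ℝ (Fin 3)

/-! ### Pointwise multilinear algebra -/

/-- The wedge product `a ∧ b` of a covector `a` and an alternating `k`-form `b`:
`(a ∧ b)(v₀,…,v_k) = ∑ i, (-1)^i a(v_i) b(v₀,…,v̂_i,…,v_k)`. -/
def wedgeAlt {k : ℕ} (a : E3 [⋀^Fin 1]→L[ℝ] ℝ) (b : E3 [⋀^Fin k]→L[ℝ] ℝ) :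
    E3 [⋀^Fin (k + 1)]→L[ℝ] ℝ :=
  ContinuousAlternatingMap.alternatizeUncurryFin
    (((ContinuousAlternatingMap.ofSubsingleton ℝ E3 ℝ (0 : Fin 1)).symm a).smulRight b)

theorem wedgeAlt_apply {k : ℕ} (a : E3 [⋀^Fin 1]→L[ℝ] ℝ) (b : E3 [⋀^Fin k]→L[ℝ] ℝ)
    (v : Fin (k + 1) → E3) :
    wedgeAlt a b v = ∑ i, (-1 : ℝ) ^ i.val * (a (fun _ => v i) * b (i.removeNth v)) := by
  rw [wedgeAlt, ContinuousAlternatingMap.alternatizeUncurryFin_apply]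
  refine Finset.sum_congr rfl fun i _ => ?_
  rw [← Int.cast_smul_eq_zsmul ℝ, smul_eq_mul]
  push_cast
  rfl

section Forms

variable (M : Type*) [TopologicalSpace M] [ChartedSpace E3 M]

/-- A (not necessarily continuous) differential `k`-form on `M`: an alternating `k`-form on each
tangent space. -/
abbrev DiffForm (k : ℕ) : Type _ := (x : M) → TangentSpace (𝓡 3) x [⋀^Fin k]→L[ℝ] ℝ

/-- A (not necessarily continuous) vector field on `M`. -/
abbrev VField : Type _ := (x : M) → TangentSpace (𝓡 3) x

variable {M}

/-- The expression of a form in a chart `e`, i.e. its pullback by `e⁻¹` (meaningful on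
`e.target`). -/
def inChart {k : ℕ} (e : OpenPartialHomeomorph M E3) (w : DiffForm M k) (y : E3) :
    E3 [⋀^Fin k]→L[ℝ] ℝ :=
  (w (e.symm y)).compContinuousLinearMap (mfderiv (𝓡 3) (𝓡 3) e.symm y)

/-- A form is smooth if its expression in every smooth chart is. -/
def IsSmoothForm {k : ℕ} (w : DiffForm M k) : Prop :=
  ∀ e ∈ IsManifold.maximalAtlas (𝓡 3) ∞ M, ContDiffOn ℝ ∞ (inChart e w) e.target

/-- A vector field is smooth if it is a smooth section of the tangent bundle. -/
def IsSmoothVField [IsManifold (𝓡 3) ∞ M] (X : VField M) : Prop :=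
  ContMDiff (𝓡 3) (𝓡 3).tangent ∞ (fun x => (⟨x, X x⟩ : TangentBundle (𝓡 3) M))

/-- The exterior derivative: at `x`, differentiate the expression of the form in the preferred
chart around `x` and pull the result back to `M` by that chart. -/
def extD {k : ℕ} (w : DiffForm M k) : DiffForm M (k + 1) := fun x =>
  ContinuousAlternatingMap.compContinuousLinearMap
    (M := TangentSpace (𝓡 3) x)
    (extDeriv (inChart (chartAt E3 x) w) (chartAt E3 x x))
    (mfderiv (𝓡 3) (𝓡 3) (chartAt E3 x) x)

/-- The interior product `i_X w = w(X, ·, …, ·)`. -/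
def interiorProd {k : ℕ} (X : VField M) (w : DiffForm M (k + 1)) : DiffForm M k := fun x =>
  ContinuousAlternatingMap.curryLeft (E := E3) (w x) (X x)

/-- The wedge product of a 1-form and a `k`-form. -/
def wedge {k : ℕ} (α : DiffForm M 1) (β : DiffForm M k) : DiffForm M (k + 1) := fun x =>
  wedgeAlt (α x) (β x)

/-- A volume form: a smooth nowhere vanishing form of top degree. -/
def IsVolumeForm (μ : DiffForm M 3) : Prop :=
  IsSmoothForm μ ∧ ∀ x, μ x ≠ 0

/-- `X` is a smooth vector field with `d i_X μ = 0`. -/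
def IsDivFree [IsManifold (𝓡 3) ∞ M] (μ : DiffForm M 3) (X : VField M) : Prop :=
  IsSmoothVField X ∧ extD (interiorProd X μ) = 0

/-! ### De Rham cohomology -/

theorem inChart_add {k : ℕ} (e : OpenPartialHomeomorph M E3) (w θ : DiffForm M k) :
    inChart e (w + θ) = inChart e w + inChart e θ := rfl

theorem inChart_smul {k : ℕ} (e : OpenPartialHomeomorph M E3) (c : ℝ) (w : DiffForm M k) :
    inChart e (c • w) = c • inChart e w := rfl

theorem inChart_zero {k : ℕ} (e : OpenPartialHomeomorph M E3) :
    inChart e (0 : DiffForm M k) = 0 := rfl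

theorem IsSmoothForm.zero {k : ℕ} : IsSmoothForm (0 : DiffForm M k) := by
  intro e _
  rw [inChart_zero]
  exact contDiffOn_const

theorem IsSmoothForm.add {k : ℕ} {w θ : DiffForm M k} (hw : IsSmoothForm w)
    (hθ : IsSmoothForm θ) : IsSmoothForm (w + θ) := by
  intro e he
  rw [inChart_add]
  exact (hw e he).add (hθ e he)

theorem IsSmoothForm.smul {k : ℕ} (c : ℝ) {w : DiffForm M k} (hw : IsSmoothForm w) :
    IsSmoothForm (c • w) := by
  intro e he
  rw [inChart_smul]
  exact (hw e he).const_smul c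

theorem IsSmoothForm.differentiableAt [IsManifold (𝓡 3) ∞ M] {k : ℕ} {w : DiffForm M k}
    (hw : IsSmoothForm w) (x : M) :
    DifferentiableAt ℝ (inChart (chartAt E3 x) w) (chartAt E3 x x) :=
  ((hw _ (IsManifold.chart_mem_maximalAtlas x)).contDiffAt
    ((chartAt E3 x).open_target.mem_nhds
      ((chartAt E3 x).map_source (mem_chart_source E3 x)))).differentiableAt (by simp)

theorem extD_add [IsManifold (𝓡 3) ∞ M] {k : ℕ} {w θ : DiffForm M k}
    (hw : IsSmoothForm w) (hθ : IsSmoothForm θ) : extD (w + θ) = extD w + extD θ := by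
  funext x
  simp only [extD, inChart_add, Pi.add_apply,
    extDeriv_add (hw.differentiableAt x) (hθ.differentiableAt x)]
  rfl

theorem extD_smul {k : ℕ} (c : ℝ) (w : DiffForm M k) : extD (c • w) = c • extD w := by
  funext x
  simp only [extD, inChart_smul, Pi.smul_apply, extDeriv_smul]
  rfl

theorem extD_zero {k : ℕ} : extD (0 : DiffForm M k) = 0 := by
  have h := extD_smul (0 : ℝ) (0 : DiffForm M k)
  rwa [zero_smul, zero_smul] at h

variable (M) [IsManifold (𝓡 3) ∞ M]

/-- The space of closed smooth `k`-forms. -/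
def closedForms (k : ℕ) : Submodule ℝ (DiffForm M k) where
  carrier := {w | IsSmoothForm w ∧ extD w = 0}
  add_mem' := fun ha hb => ⟨ha.1.add hb.1, by rw [extD_add ha.1 hb.1, ha.2, hb.2, add_zero]⟩
  zero_mem' := ⟨IsSmoothForm.zero, extD_zero⟩
  smul_mem' := fun c _ ha => ⟨ha.1.smul c, by rw [extD_smul, ha.2, smul_zero]⟩

instance closedFormsAddCommGroup (k : ℕ) : AddCommGroup (closedForms M k) :=
  (closedForms M k).addCommGroup

/-- The space of exact `k`-forms: the exterior derivatives of smooth `(k-1)`-forms, and only `0`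
in degree `0`. -/
def exactForms : (k : ℕ) → Submodule ℝ (DiffForm M k)
  | 0 => ⊥
  | _ + 1 =>
    { carrier := {w | ∃ θ, IsSmoothForm θ ∧ extD θ = w}
      add_mem' := by
        rintro _ _ ⟨a, ha, rfl⟩ ⟨b, hb, rfl⟩
        exact ⟨a + b, ha.add hb, extD_add ha hb⟩
      zero_mem' := ⟨0, IsSmoothForm.zero, extD_zero⟩
      smul_mem' := by
        rintro c _ ⟨a, ha, rfl⟩
        exact ⟨c • a, ha.smul c, extD_smul c a⟩ }

/-- Real (de Rham) cohomology `H^k(M)`: closed forms modulo exact forms. -/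
abbrev DeRhamCohomology (k : ℕ) : Type _ :=
  closedForms M k ⧸ (exactForms M k).submoduleOf (closedForms M k)

end Forms

/-! ### Orientation and integration -/

/-- An orientation of `M`, given by an oriented atlas: a family of smooth charts that covers `M`
and whose coordinate changes have positive Jacobian determinant. -/
structure OrientedAtlas (M : Type*) [TopologicalSpace M] [ChartedSpace E3 M] where
  charts : Set (OpenPartialHomeomorph M E3)
  smooth : charts ⊆ IsManifold.maximalAtlas (𝓡 3) ∞ M
  cover : ∀ x : M, ∃ e ∈ charts, x ∈ e.source
  det_pos : ∀ e ∈ charts, ∀ e' ∈ charts, ∀ y ∈ (e.symm.trans e').source,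
    0 < (fderiv ℝ (fun z => e' (e.symm z)) y).det

namespace OrientedAtlas

variable {M : Type*} [TopologicalSpace M] [ChartedSpace E3 M] [IsManifold (𝓡 3) ∞ M]
  [T2Space M] [CompactSpace M]

theorem exists_partition (o : OrientedAtlas M) :
    ∃ ρ : SmoothPartitionOfUnity o.charts (𝓡 3) M Set.univ,
      ρ.IsSubordinate (fun e => e.1.source) :=
  SmoothPartitionOfUnity.exists_isSubordinate (𝓡 3) isClosed_univ _
    (fun e => e.1.open_source) (fun x _ => by
      obtain ⟨e, he, hx⟩ := o.cover x
      exact Set.mem_iUnion.2 ⟨⟨e, he⟩, hx⟩)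

/-- A smooth partition of unity subordinate to the charts of the oriented atlas. -/
def partition (o : OrientedAtlas M) : SmoothPartitionOfUnity o.charts (𝓡 3) M Set.univ :=
  o.exists_partition.choose

/-- The integral `∫_M w` of a 3-form over the closed oriented manifold `M`: the sum over the
oriented charts `e` of the Lebesgue integrals over `e.target` of the coefficient of
`dx₁ ∧ dx₂ ∧ dx₃` in the expression of `ρ_e w`, for a partition of unity `ρ` subordinate to the
charts (only finitely many `ρ_e` are nonzero since `M` is compact). -/
def integral (o : OrientedAtlas M) (w : DiffForm M 3) : ℝ :=
  ∑ᶠ e : o.charts, ∫ y in e.1.target,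
    o.partition e (e.1.symm y) * inChart e.1 w y (EuclideanSpace.basisFun (Fin 3) ℝ)

end OrientedAtlas

/-! ### The Hopf invariant -/

section Hopf

variable {M : Type*} [TopologicalSpace M] [ChartedSpace E3 M] [IsManifold (𝓡 3) ∞ M]
  [T2Space M] [CompactSpace M]

/-- `η` is a smooth 1-form with `dη = i_X μ`. -/
def IsPrimitive (μ : DiffForm M 3) (X : VField M) (η : DiffForm M 1) : Prop :=
  IsSmoothForm η ∧ extD η = interiorProd X μ

/-- The integral `∫_M η ∧ i_Y μ`. -/
def hopfIntegral (o : OrientedAtlas M) (μ : DiffForm M 3) (η : DiffForm M 1) (Y : VField M) : ℝ :=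
  o.integral (wedge η (interiorProd Y μ))

open Classical in
/-- The Hopf invariant `H(X,Y) = ∫_M η_X ∧ i_Y μ`, for a chosen `η_X` with `dη_X = i_X μ`
(and `0` if there is none). -/
def hopfInvariant (o : OrientedAtlas M) (μ : DiffForm M 3) (X Y : VField M) : ℝ :=
  if h : ∃ η, IsPrimitive μ X η then hopfIntegral o μ h.choose Y else 0

end Hopf

end HopfInv

end

/-!
Stokes' theorem, `∫_M dφ = 0`, reduces by a partition of unity and the change of variables formula
to the vanishing of the integral of a derivative of a compactly supported function. Applied to
`d(α ∧ β) = β ∧ dα - α ∧ dβ` it makes the pairing `(α, β) ↦ ∫_M α ∧ dβ` symmetric. For primitives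
`η_X` and `η_Y` this symmetry reads `∫_M η_X ∧ i_Y μ = ∫_M η_Y ∧ i_X μ`, and since the right-hand
side does not involve `η_X`, independence of the primitive and symmetry come at once.
-/

noncomputable section

namespace HopfInv

/-! ### Stokes' theorem in a vector space -/

section VectorSpace

variable {E F : Type*} [NormedAddCommGroup E] [NormedSpace ℝ E] [NormedAddCommGroup F]
  [NormedSpace ℝ F]

theorem contDiff_indicator_of_contDiffOn {n : ℕ∞ω} {f : E → F} {U K : Set E} (hU : IsOpen U)
    (hK : IsClosed K) (hKU : K ⊆ U) (hf : ContDiffOn ℝ n f U) (h0 : ∀ x ∈ U \ K, f x = 0) :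
    ContDiff ℝ n (U.indicator f) := by
  rw [contDiff_iff_contDiffAt]
  intro x
  by_cases hx : x ∈ K
  · exact (hf.contDiffAt (hU.mem_nhds (hKU hx))).congr_of_eventuallyEq
      (Set.eqOn_indicator.eventuallyEq_of_mem (hU.mem_nhds (hKU hx)))
  · refine (contDiffAt_const (c := (0 : F))).congr_of_eventuallyEq ?_
    filter_upwards [hK.isOpen_compl.mem_nhds hx] with z hz
    exact Set.indicator_apply_eq_zero.2 fun hzU => h0 z ⟨hzU, hz⟩

theorem hasCompactSupport_indicator {X Y : Type*} [TopologicalSpace X] [R1Space X] [Zero Y]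
    {f : X → Y} {U K : Set X} (hK : IsCompact K) (h0 : ∀ x ∈ U \ K, f x = 0) :
    HasCompactSupport (U.indicator f) :=
  .intro hK fun x hx => Set.indicator_apply_eq_zero.2 fun hxU => h0 x ⟨hxU, hx⟩

theorem extDeriv_zero_apply {n : ℕ} (x : E) :
    extDeriv (0 : E → E [⋀^Fin n]→L[ℝ] F) x = 0 := by
  simpa only [zero_smul] using extDeriv_smul (0 : ℝ) (0 : E → E [⋀^Fin n]→L[ℝ] F) (x := x)

variable [MeasurableSpace E] [BorelSpace E] {ν : Measure E}

theorem integrable_fderiv_apply [IsFiniteMeasureOnCompacts ν] {f : E → F}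
    (hf : ContDiff ℝ 1 f) (hc : HasCompactSupport f) (v : E) :
    Integrable (fun x => fderiv ℝ f x v) ν :=
  ((hf.continuous_fderiv one_ne_zero).clm_apply continuous_const).integrable_of_hasCompactSupport
    (hc.fderiv_apply ℝ v)

variable [FiniteDimensional ℝ E] [ν.IsAddHaarMeasure]

theorem integral_fderiv_apply_eq_zero {f : E → F} (hf : ContDiff ℝ 1 f)
    (hc : HasCompactSupport f) (v : E) : ∫ x, fderiv ℝ f x v ∂ν = 0 := by
  simpa using integral_smul_fderiv_eq_neg_fderiv_smul_of_integrable (μ := ν)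
    (f := fun _ => (1 : ℝ)) (g := f) (v := v) (by simp)
    (by simpa using integrable_fderiv_apply hf hc v)
    (by simpa using hf.continuous.integrable_of_hasCompactSupport hc)
    (fun _ _ => differentiableAt_const _) (fun x _ => hf.differentiable one_ne_zero x)

theorem integral_extDeriv_apply_eq_zero {n : ℕ} {φ : E → E [⋀^Fin n]→L[ℝ] F}
    (hφ : ContDiff ℝ 1 φ) (hc : HasCompactSupport φ) (v : Fin (n + 1) → E) :
    ∫ x, extDeriv φ x v ∂ν = 0 := by
  have hcoeff (w : Fin n → E) : ContDiff ℝ 1 fun x => φ x w :=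
    (ContinuousAlternatingMap.apply ℝ E F w).contDiff.comp hφ
  have hcoeff_supp (w : Fin n → E) : HasCompactSupport fun x => φ x w :=
    hc.comp_left (g := fun c : E [⋀^Fin n]→L[ℝ] F => c w) rfl
  simp only [extDeriv_apply (hφ.differentiable one_ne_zero _), ← Int.cast_smul_eq_zsmul ℝ]
  rw [integral_finsetSum _ fun i _ =>
    (integrable_fderiv_apply (hcoeff _) (hcoeff_supp _) (v i)).fun_smul _]
  refine Finset.sum_eq_zero fun i _ => ?_
  rw [integral_smul, integral_fderiv_apply_eq_zero (hcoeff _) (hcoeff_supp _), smul_zero]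

theorem setIntegral_extDeriv_apply_eq_zero {n : ℕ} {φ : E → E [⋀^Fin n]→L[ℝ] F} {U K : Set E}
    (hU : IsOpen U) (hK : IsCompact K) (hKU : K ⊆ U) (hφ : ContDiffOn ℝ 1 φ U)
    (h0 : ∀ x ∈ U \ K, φ x = 0) (v : Fin (n + 1) → E) : ∫ x in U, extDeriv φ x v ∂ν = 0 := by
  have hext : Set.EqOn (fun x => extDeriv φ x v) (fun x => extDeriv (U.indicator φ) x v) U :=
    fun x hx => by
      have hev : φ =ᶠ[𝓝 x] U.indicator φ :=
        Set.eqOn_indicator.symm.eventuallyEq_of_mem (hU.mem_nhds hx)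
      simp only [hev.extDeriv_eq]
  have hoff : ∀ x ∉ U, extDeriv (U.indicator φ) x v = 0 := fun x hx => by
    have hev : U.indicator φ =ᶠ[𝓝 x] 0 := by
      filter_upwards [hK.isClosed.isOpen_compl.mem_nhds fun h => hx (hKU h)] with z hz
      exact Set.indicator_apply_eq_zero.2 fun hzU => h0 z ⟨hzU, hz⟩
    rw [hev.extDeriv_eq, extDeriv_zero_apply]
    rfl
  rw [setIntegral_congr_fun hU.measurableSet hext,
    setIntegral_eq_integral_of_forall_compl_eq_zero hoff]
  exact integral_extDeriv_apply_eq_zero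
    (contDiff_indicator_of_contDiffOn hU hK.isClosed hKU hφ h0)
    (hasCompactSupport_indicator hK h0) v

end VectorSpace

/-! ### Multilinear algebra -/

theorem compContinuousLinearMap_apply_eq_det_mul {𝕜 E ι : Type*} [NormedField 𝕜]
    [NormedAddCommGroup E] [NormedSpace 𝕜 E] [Finite ι]
    (b : Module.Basis ι 𝕜 E) (c : E [⋀^ι]→L[𝕜] 𝕜) (A : E →L[𝕜] E) (v : ι → E) :
    c.compContinuousLinearMap A v = A.det * c v := by
  classical
  have := Fintype.ofFinite ι
  have hc (u : ι → E) : c u = c b * b.det u :=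
    DFunLike.congr_fun (c.toAlternatingMap.eq_smul_basis_det b) u
  have hdet : b.det (A ∘ v) = A.det * b.det v := b.det_comp (A : E →ₗ[𝕜] E) v
  rw [ContinuousAlternatingMap.compContinuousLinearMap_apply, hc, hc v, hdet, mul_left_comm]

/-- The wedge product `wedgeAlt` as a continuous bilinear map, which makes the bilinearity, the
smoothness and the product rule of the wedge product available. -/
def wedgeAltL (k : ℕ) :
    E3 [⋀^Fin 1]→L[ℝ] ℝ →L[ℝ] E3 [⋀^Fin k]→L[ℝ] ℝ →L[ℝ] E3 [⋀^Fin (k + 1)]→L[ℝ] ℝ :=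
  ContinuousLinearMap.compL ℝ _ _ _ (ContinuousAlternatingMap.alternatizeUncurryFinCLM ℝ E3 ℝ) ∘L
    ContinuousLinearMap.smulRightL ℝ E3 (E3 [⋀^Fin k]→L[ℝ] ℝ) ∘L
    (ContinuousAlternatingMap.ofSubsingletonLIE (𝕜 := ℝ) (E := E3) (F := ℝ)
      (0 : Fin 1)).symm.toContinuousLinearEquiv.toContinuousLinearMap

theorem wedgeAlt_compContinuousLinearMap {k : ℕ} (a : E3 [⋀^Fin 1]→L[ℝ] ℝ)
    (b : E3 [⋀^Fin k]→L[ℝ] ℝ) (A : E3 →L[ℝ] E3) :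
    (wedgeAlt a b).compContinuousLinearMap A =
      wedgeAlt (a.compContinuousLinearMap A) (b.compContinuousLinearMap A) := by
  ext v
  simp only [ContinuousAlternatingMap.compContinuousLinearMap_apply, wedgeAlt_apply]
  rfl

theorem extDeriv_wedgeAlt {a b : E3 → E3 [⋀^Fin 1]→L[ℝ] ℝ} {y : E3}
    (ha : DifferentiableAt ℝ a y) (hb : DifferentiableAt ℝ b y) :
    extDeriv (fun z => wedgeAlt (a z) (b z)) y =
      wedgeAlt (b y) (extDeriv a y) - wedgeAlt (a y) (extDeriv b y) := by
  have hprod (u : E3) : fderiv ℝ (fun z => wedgeAlt (a z) (b z)) y u =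
      wedgeAlt (a y) (fderiv ℝ b y u) + wedgeAlt (fderiv ℝ a y u) (b y) :=
    DFunLike.congr_fun ((wedgeAltL 1).hasFDerivAt_of_bilinear ha.hasFDerivAt hb.hasFDerivAt).fderiv
      u
  have hremove (i : Fin 2) (u : Fin 2 → E3) : i.removeNth u = fun _ => u (i.succAbove 0) :=
    funext fun j => by rw [Subsingleton.elim j 0]; rfl
  ext v
  rw [ContinuousAlternatingMap.sub_apply]
  simp only [extDeriv, ContinuousAlternatingMap.alternatizeUncurryFin_apply, hprod, wedgeAlt_apply,
    ContinuousAlternatingMap.add_apply, hremove]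
  simp only [Nat.reduceAdd, Fin.sum_univ_three, Fin.sum_univ_two, Fin.val_zero, Fin.val_one,
    Fin.val_two, Fin.removeNth_apply, Fin.succAbove, Fin.reduceCastSucc, Fin.reduceSucc,
    Fin.reduceLT, ↓reduceIte, zsmul_eq_mul]
  push_cast
  ring

/-! ### Forms and vector fields in charts -/

section Charts

variable {𝕜 E H M : Type*} [NontriviallyNormedField 𝕜] [NormedAddCommGroup E] [NormedSpace 𝕜 E]
  [TopologicalSpace M] {n : ℕ∞ω}

theorem mdifferentiable_of_mem_maximalAtlas [TopologicalSpace H] {I : ModelWithCorners 𝕜 E H}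
    [ChartedSpace H M] (hn : n ≠ 0) {e : OpenPartialHomeomorph M H}
    (he : e ∈ IsManifold.maximalAtlas I n M) : e.MDifferentiable I I :=
  ⟨(contMDiffOn_of_mem_maximalAtlas he).mdifferentiableOn hn,
    (contMDiffOn_symm_of_mem_maximalAtlas he).mdifferentiableOn hn⟩

variable [ChartedSpace E M] {e e' : OpenPartialHomeomorph M E}

theorem contDiffAt_transition (he : e ∈ IsManifold.maximalAtlas 𝓘(𝕜, E) n M)
    (he' : e' ∈ IsManifold.maximalAtlas 𝓘(𝕜, E) n M) {y : E} (hy : y ∈ e.target)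
    (hy' : e.symm y ∈ e'.source) : ContDiffAt 𝕜 n (fun z => e' (e.symm z)) y :=
  contMDiffAt_iff_contDiffAt.1 <|
    (contMDiffAt_of_mem_maximalAtlas he' hy').comp y (contMDiffAt_symm_of_mem_maximalAtlas he hy)

theorem fderiv_transition (he : e.MDifferentiable 𝓘(𝕜, E) 𝓘(𝕜, E))
    (he' : e'.MDifferentiable 𝓘(𝕜, E) 𝓘(𝕜, E)) {y : E} (hy : y ∈ e.target)
    (hy' : e.symm y ∈ e'.source) :
    fderiv 𝕜 (fun z => e' (e.symm z)) y =
      (mfderiv 𝓘(𝕜, E) 𝓘(𝕜, E) e' (e.symm y)).comp (mfderiv 𝓘(𝕜, E) 𝓘(𝕜, E) e.symm y) := by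
  rw [← mfderiv_comp y (he'.mdifferentiableAt hy') (he.mdifferentiableAt_symm hy),
    mfderiv_eq_fderiv]
  rfl

theorem contDiffOn_comp_symm (he : e ∈ IsManifold.maximalAtlas 𝓘(𝕜, E) n M) {F : Type*}
    [NormedAddCommGroup F] [NormedSpace 𝕜 F] {f : M → F} (hf : ContMDiff 𝓘(𝕜, E) 𝓘(𝕜, F) n f) :
    ContDiffOn 𝕜 n (fun y => f (e.symm y)) e.target :=
  contMDiffOn_iff_contDiffOn.1 <| hf.comp_contMDiffOn (contMDiffOn_symm_of_mem_maximalAtlas he)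

end Charts

section Forms

variable {M : Type*} [TopologicalSpace M] [ChartedSpace E3 M] {k : ℕ}
  {e e' : OpenPartialHomeomorph M E3}

theorem inChart_eq_zero {w : DiffForm M k} {y : E3} (h : w (e.symm y) = 0) :
    inChart e w y = 0 := by
  rw [inChart, h]
  rfl

theorem inChart_wedge (α : DiffForm M 1) (β : DiffForm M k) (y : E3) :
    inChart e (wedge α β) y = wedgeAlt (inChart e α y) (inChart e β y) :=
  wedgeAlt_compContinuousLinearMap _ _ _

theorem inChart_compContinuousLinearMap_mfderiv (he : e.MDifferentiable (𝓡 3) (𝓡 3))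
    (w : DiffForm M k) {x : M} (hx : x ∈ e.source) :
    (inChart e w (e x)).compContinuousLinearMap (mfderiv (𝓡 3) (𝓡 3) e x : E3 →L[ℝ] E3) =
      w x := by
  let w' : M → E3 [⋀^Fin k]→L[ℝ] ℝ := w
  let D : E3 →L[ℝ] E3 :=
    (mfderiv (𝓡 3) (𝓡 3) e.symm (e x) : E3 →L[ℝ] E3).comp
      (mfderiv (𝓡 3) (𝓡 3) e x : E3 →L[ℝ] E3)
  have hD : D = ContinuousLinearMap.id ℝ E3 := he.symm_comp_deriv hx
  change (w' (e.symm (e x))).compContinuousLinearMap D = w' x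
  rw [hD, e.left_inv hx]
  rfl

theorem inChart_eq_pullback (he : e.MDifferentiable (𝓡 3) (𝓡 3))
    (he' : e'.MDifferentiable (𝓡 3) (𝓡 3)) (w : DiffForm M k) {y : E3} (hy : y ∈ e.target)
    (hy' : e.symm y ∈ e'.source) :
    inChart e w y = (inChart e' w (e' (e.symm y))).compContinuousLinearMap
      (fderiv ℝ (fun z => e' (e.symm z)) y) := by
  rw [fderiv_transition he he' hy hy', inChart,
    ← inChart_compContinuousLinearMap_mfderiv he' w hy']
  rfl

theorem inChart_interiorProd (he : e.MDifferentiable (𝓡 3) (𝓡 3)) (X : VField M)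
    (w : DiffForm M (k + 1)) {y : E3} (hy : y ∈ e.target) :
    inChart e (interiorProd X w) y =
      (inChart e w y).curryLeft (VectorField.mpullback (𝓡 3) (𝓡 3) e.symm X y) := by
  have hinv : (mfderiv (𝓡 3) (𝓡 3) e.symm y).IsInvertible := ⟨he.symm.mfderiv hy, rfl⟩
  let c : E3 [⋀^Fin (k + 1)]→L[ℝ] ℝ := w (e.symm y)
  let A : E3 →L[ℝ] E3 := mfderiv (𝓡 3) (𝓡 3) e.symm y
  let v : E3 := X (e.symm y)
  let u : E3 := VectorField.mpullback (𝓡 3) (𝓡 3) e.symm X y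
  have hAu : A u = v := hinv.self_apply_inverse _
  change (c.curryLeft v).compContinuousLinearMap A = (c.compContinuousLinearMap A).curryLeft u
  rw [ContinuousAlternatingMap.curryLeft_compContinuousLinearMap, hAu]

theorem IsSmoothForm.fun_smul {f : M → ℝ} (hf : ContMDiff (𝓡 3) 𝓘(ℝ, ℝ) ∞ f)
    {w : DiffForm M k} (hw : IsSmoothForm w) :
    IsSmoothForm (fun x => f x • w x : DiffForm M k) := fun e he =>
  (contDiffOn_comp_symm he hf).smul (hw e he)

theorem IsSmoothForm.wedge {α : DiffForm M 1} {β : DiffForm M k} (hα : IsSmoothForm α)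
    (hβ : IsSmoothForm β) : IsSmoothForm (wedge α β) := fun e he =>
  ((wedgeAltL k).isBoundedBilinearMap.contDiff.comp_contDiffOn
    ((hα e he).prodMk (hβ e he))).congr fun y _ => inChart_wedge α β y

theorem wedge_add_right (α : DiffForm M 1) (β β' : DiffForm M k) :
    wedge α (β + β') = wedge α β + wedge α β' :=
  funext fun x => map_add (wedgeAltL k (α x)) (β x) (β' x)

theorem interiorProd_add (X Y : VField M) (w : DiffForm M (k + 1)) :
    interiorProd (X + Y) w = interiorProd X w + interiorProd Y w :=
  funext fun x => map_add (ContinuousAlternatingMap.curryLeft (E := E3) (w x)) (X x) (Y x)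

variable [IsManifold (𝓡 3) ∞ M]

theorem inChart_extD (he : e ∈ IsManifold.maximalAtlas (𝓡 3) ∞ M) {w : DiffForm M k}
    (hw : IsSmoothForm w) {y : E3} (hy : y ∈ e.target) :
    inChart e (extD w) y = extDeriv (inChart e w) y := by
  set c := chartAt E3 (e.symm y)
  have hc : c ∈ IsManifold.maximalAtlas (𝓡 3) ∞ M := IsManifold.chart_mem_maximalAtlas _
  have hcd := mdifferentiable_of_mem_maximalAtlas (by simp) hc
  have hed := mdifferentiable_of_mem_maximalAtlas (by simp) he
  have hyc : e.symm y ∈ c.source := mem_chart_source E3 _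
  have hpullback : inChart e w =ᶠ[𝓝 y] fun z =>
      (inChart c w (c (e.symm z))).compContinuousLinearMap
        (fderiv ℝ (fun z => c (e.symm z)) z) := by
    filter_upwards [(e.continuousAt_symm hy).preimage_mem_nhds (c.open_source.mem_nhds hyc),
      e.open_target.mem_nhds hy] with z hzc hze
    exact inChart_eq_pullback hed hcd w hze hzc
  rw [hpullback.extDeriv_eq, extDeriv_pullback (r := ∞) (f := fun z => c (e.symm z))
    (hw.differentiableAt (e.symm y)) (contDiffAt_transition he hc hy hyc)
    (by rw [minSmoothness_of_isRCLikeNormedField]; exact WithTop.coe_le_coe.2 le_top),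
    fderiv_transition hed hcd hy hyc]
  rfl

theorem IsSmoothForm.extD {w : DiffForm M k} (hw : IsSmoothForm w) : IsSmoothForm (extD w) := by
  intro e he
  have hfderiv : ContDiffOn ℝ ∞ (fderiv ℝ (inChart e w)) e.target :=
    (hw e he).fderiv_of_isOpen e.open_target (by simp)
  refine ContDiffOn.congr ?_ fun y hy => inChart_extD he hw hy
  exact (ContinuousAlternatingMap.alternatizeUncurryFinCLM ℝ E3 ℝ).contDiff.comp_contDiffOn
    hfderiv

theorem IsSmoothVField.contDiffOn_mpullback {X : VField M} (hX : IsSmoothVField X)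
    (he : e ∈ IsManifold.maximalAtlas (𝓡 3) ∞ M) :
    ContDiffOn ℝ ∞ (VectorField.mpullback (𝓡 3) (𝓡 3) e.symm X : E3 → E3) e.target := fun y hy =>
  have hinv : (mfderiv (𝓡 3) (𝓡 3) e.symm y).IsInvertible :=
    ⟨(mdifferentiable_of_mem_maximalAtlas (by simp) he).symm.mfderiv hy, rfl⟩
  (contMDiffWithinAt_vectorSpace_iff_contDiffWithinAt.1
    ((hX (e.symm y)).mpullback_vectorField_preimage
      (contMDiffAt_symm_of_mem_maximalAtlas he hy) hinv (by simp)).contMDiffWithinAt)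

theorem IsSmoothForm.interiorProd {X : VField M} (hX : IsSmoothVField X)
    {w : DiffForm M (k + 1)} (hw : IsSmoothForm w) : IsSmoothForm (interiorProd X w) := by
  intro e he
  refine ContDiffOn.congr (f := fun y => (inChart e w y).curryLeft
    (VectorField.mpullback (𝓡 3) (𝓡 3) e.symm X y : E3)) ?_ fun y hy =>
    inChart_interiorProd (mdifferentiable_of_mem_maximalAtlas (by simp) he) X w hy
  refine ContDiffOn.clm_apply ?_ (hX.contDiffOn_mpullback he)
  exact (ContinuousLinearMap.contDiff (F := E3 →L[ℝ] E3 [⋀^Fin k]→L[ℝ] ℝ)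
    (ContinuousAlternatingMap.curryLeftLI (n := k) (𝕜 := ℝ) (E := E3)
      (F := ℝ)).toContinuousLinearMap).comp_contDiffOn (hw e he)

theorem extD_wedge {α β : DiffForm M 1} (hα : IsSmoothForm α) (hβ : IsSmoothForm β) :
    extD (wedge α β) = wedge β (extD α) - wedge α (extD β) := by
  funext x
  set c := chartAt E3 x
  let A : E3 →L[ℝ] E3 := mfderiv (𝓡 3) (𝓡 3) c x
  have hpull (γ : DiffForm M 1) : (inChart c γ (c x)).compContinuousLinearMap A = γ x :=
    inChart_compContinuousLinearMap_mfderiv (mdifferentiable_chart x) γ (mem_chart_source E3 x)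
  have hwedge : inChart c (wedge α β) = fun y => wedgeAlt (inChart c α y) (inChart c β y) :=
    funext (inChart_wedge α β)
  change (extDeriv (inChart c (wedge α β)) (c x)).compContinuousLinearMap A =
    wedgeAlt (β x) ((extDeriv (inChart c α) (c x)).compContinuousLinearMap A) -
      wedgeAlt (α x) ((extDeriv (inChart c β) (c x)).compContinuousLinearMap A)
  rw [hwedge, extDeriv_wedgeAlt (hα.differentiableAt x) (hβ.differentiableAt x), ← hpull α,
    ← hpull β, ← wedgeAlt_compContinuousLinearMap, ← wedgeAlt_compContinuousLinearMap]
  rfl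

end Forms

/-! ### Stokes' theorem on a closed manifold -/

section Support

variable {M : Type*} [TopologicalSpace M] [ChartedSpace E3 M] {k : ℕ}
  {e : OpenPartialHomeomorph M E3} {K : Set M}

theorem inChart_eq_zero_of_notMem_image {w : DiffForm M k} (h0 : ∀ x ∉ K, w x = 0) {y : E3}
    (hy : y ∈ e.target \ e '' K) : inChart e w y = 0 :=
  inChart_eq_zero (h0 _ fun hyK => hy.2 ⟨_, hyK, e.right_inv hy.1⟩)

theorem extD_eq_zero_of_notMem {w : DiffForm M k} (hK : IsClosed K) (h0 : ∀ x ∉ K, w x = 0)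
    {x : M} (hx : x ∉ K) : extD w x = 0 := by
  set c := chartAt E3 x
  have hxc : x ∈ c.source := mem_chart_source E3 x
  have hev : inChart c w =ᶠ[𝓝 (c x)] 0 := by
    filter_upwards [(c.continuousAt_symm (c.map_source hxc)).preimage_mem_nhds
      (by rw [c.left_inv hxc]; exact hK.isOpen_compl.mem_nhds hx)] with z hz
    exact inChart_eq_zero (h0 _ hz)
  rw [extD, hev.extDeriv_eq, extDeriv_zero_apply]
  rfl

/-- The integral of a 3-form over the domain of the chart `e`, computed in the coordinates of
`e`. -/
def chartIntegral (e : OpenPartialHomeomorph M E3) (w : DiffForm M 3) : ℝ :=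
  ∫ y in e.target, inChart e w y (EuclideanSpace.basisFun (Fin 3) ℝ)

theorem chartIntegral_eq_setIntegral {s : Set E3} (hs : s ⊆ e.target) {w : DiffForm M 3}
    (h0 : ∀ y ∈ e.target \ s, w (e.symm y) = 0) :
    chartIntegral e w = ∫ y in s, inChart e w y (EuclideanSpace.basisFun (Fin 3) ℝ) :=
  setIntegral_eq_of_subset_of_forall_sdiff_eq_zero e.open_target.measurableSet hs fun y hy => by
    rw [inChart_eq_zero (h0 y hy)]
    rfl

theorem integrableOn_inChart_apply [IsManifold (𝓡 3) ∞ M]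
    (he : e ∈ IsManifold.maximalAtlas (𝓡 3) ∞ M) {w : DiffForm M k} (hw : IsSmoothForm w)
    (hK : IsCompact K) (hKe : K ⊆ e.source) (h0 : ∀ x ∉ K, w x = 0) (v : Fin k → E3) :
    IntegrableOn (fun y => inChart e w y v) e.target := by
  have hcont : ContinuousOn (fun y => inChart e w y v) e.target :=
    (ContinuousAlternatingMap.apply ℝ E3 ℝ v).continuous.comp_continuousOn (hw e he).continuousOn
  have hcompact : IsCompact (e '' K) := hK.image_of_continuousOn (e.continuousOn.mono hKe)
  refine ((hcont.mono (e.mapsTo.mono_left hKe).image_subset).integrableOn_compact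
    hcompact).of_forall_sdiff_eq_zero e.open_target.measurableSet fun y hy => ?_
  rw [inChart_eq_zero_of_notMem_image h0 hy]
  rfl

theorem chartIntegral_extD_eq_zero [IsManifold (𝓡 3) ∞ M]
    (he : e ∈ IsManifold.maximalAtlas (𝓡 3) ∞ M) {w : DiffForm M 2} (hw : IsSmoothForm w)
    (hK : IsCompact K) (hKe : K ⊆ e.source) (h0 : ∀ x ∉ K, w x = 0) :
    chartIntegral e (extD w) = 0 := by
  have hderiv : chartIntegral e (extD w) =
      ∫ y in e.target, extDeriv (inChart e w) y (EuclideanSpace.basisFun (Fin 3) ℝ) :=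
    setIntegral_congr_fun e.open_target.measurableSet fun y hy => by
      simp only [inChart_extD he hw hy]
  rw [hderiv]
  exact setIntegral_extDeriv_apply_eq_zero e.open_target
    (hK.image_of_continuousOn (e.continuousOn.mono hKe)) (e.mapsTo.mono_left hKe).image_subset
    ((hw e he).of_le (by simp)) (fun y hy => inChart_eq_zero_of_notMem_image h0 hy) _

theorem OrientedAtlas.chartIntegral_eq_chartIntegral [IsManifold (𝓡 3) ∞ M] (o : OrientedAtlas M)
    {e' : OpenPartialHomeomorph M E3} (he : e ∈ o.charts) (he' : e' ∈ o.charts)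
    {w : DiffForm M 3} (h0 : ∀ x ∉ e.source ∩ e'.source, w x = 0) :
    chartIntegral e' w = chartIntegral e w := by
  set τ := e.symm.trans e'
  have hτ_source {y : E3} (hy : y ∈ τ.source) : y ∈ e.target ∧ e.symm y ∈ e'.source := by
    simpa [τ] using hy
  have hderiv : ∀ y ∈ τ.source, HasFDerivAt τ (fderiv ℝ (fun z => e' (e.symm z)) y) y :=
    fun y hy => ((contDiffAt_transition (o.smooth he) (o.smooth he') (hτ_source hy).1
      (hτ_source hy).2).differentiableAt (by simp)).hasFDerivAt
  rw [chartIntegral_eq_setIntegral (e := e') (s := τ.target) (fun y hy => hy.1) fun y hy =>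
      h0 _ fun h => hy.2 ⟨hy.1, by simpa using h.1⟩,
    chartIntegral_eq_setIntegral (e := e) (s := τ.source) (fun y hy => hy.1) fun y hy =>
      h0 _ fun h => hy.2 ⟨hy.1, h.2⟩,
    integral_target_eq_integral_abs_det_fderiv_smul volume hderiv]
  refine setIntegral_congr_fun τ.open_source.measurableSet fun y hy => ?_
  simp only [abs_of_pos (o.det_pos e he e' he' y hy), smul_eq_mul]
  rw [inChart_eq_pullback (mdifferentiable_of_mem_maximalAtlas (by simp) (o.smooth he))
    (mdifferentiable_of_mem_maximalAtlas (by simp) (o.smooth he')) w (hτ_source hy).1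
    (hτ_source hy).2,
    compContinuousLinearMap_apply_eq_det_mul (EuclideanSpace.basisFun (Fin 3) ℝ).toBasis]
  rfl

end Support

namespace OrientedAtlas

variable {M : Type*} [TopologicalSpace M] [ChartedSpace E3 M] [IsManifold (𝓡 3) ∞ M]
  [T2Space M] [CompactSpace M] {k : ℕ} (o : OrientedAtlas M)

theorem tsupport_partition_subset (e : o.charts) : tsupport (o.partition e) ⊆ e.1.source :=
  o.exists_partition.choose_spec e

theorem finite_setOf_nonempty_support_partition :
    {e : o.charts | (Function.support (o.partition e)).Nonempty}.Finite :=
  o.partition.locallyFinite.finite_nonempty_of_compact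

/-- The charts on which the partition of unity is not identically zero. Compactness makes them
finite in number, so that integrals and forms decompose into finite sums over them. -/
def activeCharts : Finset o.charts := o.finite_setOf_nonempty_support_partition.toFinset

theorem partition_apply_eq_zero {e : o.charts} (he : e ∉ o.activeCharts) (x : M) :
    o.partition e x = 0 := by
  by_contra h
  exact he (o.finite_setOf_nonempty_support_partition.mem_toFinset.2 ⟨x, h⟩)

theorem sum_partition (x : M) : ∑ e ∈ o.activeCharts, o.partition e x = 1 := by
  rw [← o.partition.sum_eq_one (Set.mem_univ x)]
  refine (finsum_eq_sum_of_support_subset _ fun e he => ?_).symm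
  by_contra h
  exact he (o.partition_apply_eq_zero h x)

/-- The part `ρ_e w` of the form `w` cut out by the partition of unity at the chart `e`. -/
def localized (e : o.charts) (w : DiffForm M k) : DiffForm M k := fun x => o.partition e x • w x

theorem sum_localized (w : DiffForm M k) : ∑ e ∈ o.activeCharts, o.localized e w = w := by
  funext x
  rw [Finset.sum_apply]
  simp only [localized]
  rw [← Finset.sum_smul, sum_partition, one_smul]

theorem isSmoothForm_localized (e : o.charts) {w : DiffForm M k} (hw : IsSmoothForm w) :
    IsSmoothForm (o.localized e w) :=
  .fun_smul (o.partition e).contMDiff hw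

theorem localized_apply_eq_zero (e : o.charts) (w : DiffForm M k) {x : M}
    (hx : x ∉ tsupport (o.partition e)) : o.localized e w x = 0 := by
  rw [localized, image_eq_zero_of_notMem_tsupport hx, zero_smul]

theorem inChart_localized_apply (e : o.charts) (w : DiffForm M k)
    (e' : OpenPartialHomeomorph M E3) (y : E3) (v : Fin k → E3) :
    inChart e' (o.localized e w) y v = o.partition e (e'.symm y) * inChart e' w y v := rfl

theorem integral_eq_sum_chartIntegral (w : DiffForm M 3) :
    o.integral w = ∑ e ∈ o.activeCharts, chartIntegral e.1 (o.localized e w) := by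
  refine finsum_eq_sum_of_support_subset _ fun e he => ?_
  by_contra h
  exact he (by simp [o.partition_apply_eq_zero h])

theorem integral_add {w θ : DiffForm M 3} (hw : IsSmoothForm w) (hθ : IsSmoothForm θ) :
    o.integral (w + θ) = o.integral w + o.integral θ := by
  have hint (e : o.charts) {φ : DiffForm M 3} (hφ : IsSmoothForm φ) :
      IntegrableOn (fun y => inChart e.1 (o.localized e φ) y (EuclideanSpace.basisFun (Fin 3) ℝ))
        e.1.target :=
    integrableOn_inChart_apply (o.smooth e.2) (o.isSmoothForm_localized e hφ)
      (isClosed_tsupport _).isCompact (o.tsupport_partition_subset e)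
      (fun _ => o.localized_apply_eq_zero e φ) _
  simp only [integral_eq_sum_chartIntegral, ← Finset.sum_add_distrib]
  refine Finset.sum_congr rfl fun e _ => ?_
  rw [chartIntegral, chartIntegral, chartIntegral,
    ← MeasureTheory.integral_add (hint e hw) (hint e hθ)]
  simp only [inChart_localized_apply, inChart_add, Pi.add_apply, mul_add,
    ContinuousAlternatingMap.add_apply]

theorem integral_eq_chartIntegral {e : OpenPartialHomeomorph M E3} (he : e ∈ o.charts)
    {w : DiffForm M 3} (hw : IsSmoothForm w) {K : Set M} (hK : IsCompact K) (hKe : K ⊆ e.source)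
    (h0 : ∀ x ∉ K, w x = 0) : o.integral w = chartIntegral e w := by
  have h0_localized (e' : o.charts) (x : M) (hx : x ∉ K) : o.localized e' w x = 0 := by
    rw [localized, h0 x hx, smul_zero]
  have hchange (e' : o.charts) :
      chartIntegral e'.1 (o.localized e' w) = chartIntegral e (o.localized e' w) := by
    refine o.chartIntegral_eq_chartIntegral he e'.2 fun x hx => ?_
    by_cases hxK : x ∈ K
    · exact o.localized_apply_eq_zero e' w fun h =>
        hx ⟨hKe hxK, o.tsupport_partition_subset e' h⟩
    · exact h0_localized e' x hxK
  rw [integral_eq_sum_chartIntegral, Finset.sum_congr rfl fun e' _ => hchange e']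
  simp only [chartIntegral]
  rw [← integral_finsetSum _ fun e' _ => integrableOn_inChart_apply (o.smooth he)
    (o.isSmoothForm_localized e' hw) hK hKe (h0_localized e') _]
  simp only [inChart_localized_apply, ← Finset.sum_mul, sum_partition, one_mul]

theorem integral_extD_eq_zero {w : DiffForm M 2} (hw : IsSmoothForm w) :
    o.integral (extD w) = 0 := by
  have hlocal (e : o.charts) : o.integral (extD (o.localized e w)) = 0 := by
    have hK : IsCompact (tsupport (o.partition e)) := (isClosed_tsupport _).isCompact
    have h0 (x : M) (hx : x ∉ tsupport (o.partition e)) : o.localized e w x = 0 :=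
      o.localized_apply_eq_zero e w hx
    have hsmooth : IsSmoothForm (o.localized e w) := o.isSmoothForm_localized e hw
    rw [o.integral_eq_chartIntegral e.2 hsmooth.extD hK (o.tsupport_partition_subset e) fun _ =>
      extD_eq_zero_of_notMem hK.isClosed h0]
    exact chartIntegral_extD_eq_zero (o.smooth e.2) hsmooth hK (o.tsupport_partition_subset e) h0
  have hsum := Finset.sum_induction (s := o.activeCharts) (fun e => o.localized e w)
    (fun φ => IsSmoothForm φ ∧ o.integral (extD φ) = 0)
    (fun φ ψ hφ hψ => ⟨hφ.1.add hψ.1, by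
      rw [extD_add hφ.1 hψ.1, o.integral_add hφ.1.extD hψ.1.extD, hφ.2, hψ.2, add_zero]⟩)
    ⟨.zero, by simp [integral, extD_zero, inChart_zero]⟩
    (fun e _ => ⟨o.isSmoothForm_localized e hw, hlocal e⟩)
  rw [← o.sum_localized w]
  exact hsum.2

theorem integral_wedge_extD_comm {α β : DiffForm M 1} (hα : IsSmoothForm α)
    (hβ : IsSmoothForm β) : o.integral (wedge α (extD β)) = o.integral (wedge β (extD α)) := by
  have hleibniz : wedge β (extD α) = extD (wedge α β) + wedge α (extD β) :=
    sub_eq_iff_eq_add.1 (extD_wedge hα hβ).symm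
  rw [hleibniz, o.integral_add (hα.wedge hβ).extD (hα.wedge hβ.extD),
    o.integral_extD_eq_zero (hα.wedge hβ), zero_add]

end OrientedAtlas

/-! ### The Hopf invariant -/

section Hopf

variable {M : Type*} [TopologicalSpace M] [ChartedSpace E3 M] [IsManifold (𝓡 3) ∞ M]
  {μ : DiffForm M 3} {X Y Z : VField M} {η ζ : DiffForm M 1}

theorem exists_extD_eq {k : ℕ} (h : Subsingleton (DeRhamCohomology M (k + 1)))
    {w : DiffForm M (k + 1)} (hw : IsSmoothForm w) (hd : extD w = 0) :
    ∃ θ, IsSmoothForm θ ∧ extD θ = w :=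
  (Submodule.Quotient.mk_eq_zero ((exactForms M (k + 1)).submoduleOf (closedForms M (k + 1)))
    (x := ⟨w, hw, hd⟩)).1 (h.allEq _ _)

theorem IsDivFree.exists_isPrimitive (hX : IsDivFree μ X)
    (hH2 : Subsingleton (DeRhamCohomology M 2)) (hμ : IsSmoothForm μ) :
    ∃ η, IsPrimitive μ X η :=
  exists_extD_eq hH2 (hμ.interiorProd hX.1) hX.2

variable [T2Space M] [CompactSpace M] (o : OrientedAtlas M)

theorem hopfIntegral_comm (hη : IsPrimitive μ X η) (hζ : IsPrimitive μ Y ζ) :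
    hopfIntegral o μ η Y = hopfIntegral o μ ζ X := by
  rw [hopfIntegral, hopfIntegral, ← hη.2, ← hζ.2]
  exact o.integral_wedge_extD_comm hη.1 hζ.1

theorem hopfIntegral_add (hμ : IsSmoothForm μ) (hη : IsSmoothForm η) (hY : IsSmoothVField Y)
    (hZ : IsSmoothVField Z) :
    hopfIntegral o μ η (Y + Z) = hopfIntegral o μ η Y + hopfIntegral o μ η Z := by
  rw [hopfIntegral, interiorProd_add, wedge_add_right]
  exact o.integral_add (hη.wedge (hμ.interiorProd hY)) (hη.wedge (hμ.interiorProd hZ))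

theorem exists_hopfInvariant_eq_hopfIntegral (h : ∃ η, IsPrimitive μ X η) :
    ∃ η, IsPrimitive μ X η ∧ ∀ Y, hopfInvariant o μ X Y = hopfIntegral o μ η Y :=
  ⟨h.choose, h.choose_spec, fun _ => dif_pos h⟩

end Hopf

end HopfInv

end

open HopfInv in
theorem mainTheorem5_general {M : Type*} [TopologicalSpace M] [ChartedSpace E3 M]
    [IsManifold (𝓡 3) ∞ M] [T2Space M] [CompactSpace M]
    (o : OrientedAtlas M) (hH2 : Subsingleton (DeRhamCohomology M 2))
    (μ : DiffForm M 3) (hμ : IsSmoothForm μ) (X Y Z : VField M)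
    (hX : IsDivFree μ X) (hY : IsDivFree μ Y) (hZ : IsSmoothVField Z) :
    (∃ η, IsPrimitive μ X η) ∧
    (∀ η η', IsPrimitive μ X η → IsPrimitive μ X η' →
      hopfIntegral o μ η Y = hopfIntegral o μ η' Y) ∧
    (∀ η, IsPrimitive μ X η →
      hopfInvariant o μ X Y = hopfIntegral o μ η Y) ∧
    hopfInvariant o μ X Y = hopfInvariant o μ Y X ∧
    hopfInvariant o μ X (Y + Z) =
      hopfInvariant o μ X Y + hopfInvariant o μ X Z := by
  obtain ⟨ηX, hηX, hHX⟩ :=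
    exists_hopfInvariant_eq_hopfIntegral o (hX.exists_isPrimitive hH2 hμ)
  obtain ⟨ηY, hηY, hHY⟩ :=
    exists_hopfInvariant_eq_hopfIntegral o (hY.exists_isPrimitive hH2 hμ)
  have hindep : ∀ η, IsPrimitive μ X η →
      hopfIntegral o μ η Y = hopfIntegral o μ ηY X :=
    fun η hη => hopfIntegral_comm o hη hηY
  refine ⟨⟨ηX, hηX⟩, fun η η' hη hη' => ?_, fun η hη => ?_, ?_, ?_⟩
  · rw [hindep η hη, hindep η' hη']
  · rw [hHX, hindep ηX hηX, hindep η hη]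
  · rw [hHX, hHY, hindep ηX hηX]
  · rw [hHX, hHX, hHX, hopfIntegral_add o hμ hηX.1 hY.1 hZ]

theorem mainTheorem5 {M : Type*} [TopologicalSpace M] [ChartedSpace HopfInv.E3 M]
    [IsManifold (𝓡 3) ∞ M] [T2Space M] [CompactSpace M]
    (o : HopfInv.OrientedAtlas M)
    (hH1 : Subsingleton (HopfInv.DeRhamCohomology M 1))
    (hH2 : Subsingleton (HopfInv.DeRhamCohomology M 2))
    (μ : HopfInv.DiffForm M 3) (hμ : HopfInv.IsVolumeForm μ)
    (X Y Z : HopfInv.VField M)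
    (hX : HopfInv.IsDivFree μ X) (hY : HopfInv.IsDivFree μ Y) (hZ : HopfInv.IsDivFree μ Z) :
    (∃ η, HopfInv.IsPrimitive μ X η) ∧
    (∀ η η', HopfInv.IsPrimitive μ X η → HopfInv.IsPrimitive μ X η' →
      HopfInv.hopfIntegral o μ η Y = HopfInv.hopfIntegral o μ η' Y) ∧
    (∀ η, HopfInv.IsPrimitive μ X η →
      HopfInv.hopfInvariant o μ X Y = HopfInv.hopfIntegral o μ η Y) ∧
    HopfInv.hopfInvariant o μ X Y = HopfInv.hopfInvariant o μ Y X ∧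
    HopfInv.hopfInvariant o μ X (Y + Z) =
      HopfInv.hopfInvariant o μ X Y + HopfInv.hopfInvariant o μ X Z :=
  mainTheorem5_general o hH2 μ hμ.1 X Y Z hX hY hZ.1
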